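/- Let $q$ be an odd prime power of the form $q=2am-1$ with integers $a\ge 1$ and $m\ge 2$, and let $d$ be an integer with $2\le d\le (a+1)m-2$. Then there exists a $q$-ary $$\left[\left[\frac{q^2-1}{2a}-q+1,\ \frac{q^2-1}{2a}-q-2d+3,\ d\right]\right]$$ quantum MDS code. Here, let $p$ be the characteristic of $\mathbb{F}_q$ and $\zeta_p=e^{2\pi i/p}$, and let $\mathbb{C}^{q^n}\cong(\mathbb{C}^q)^{\otimes n}$ have the orthonormal basis $\{|x\rangle : x\in\mathbb{F}_q^n\}$. The errors are the operators $\zeta_p^lT^{\alpha}R^{\beta}$ with $0\le l\le p-1$, $\alpha,\beta\in\mathbb{F}_q^n$, given by $\zeta_p^lT^{\alpha}R^{\beta}|x\rangle=\zeta_p^{\,l+\mathrm{Tr}_{\mathbb{F}_q/\mathbb{F}_p}(\beta\cdot x)}|x+\alpha\rangle$, and the weight of such an error is the number of $i$ with $(\alpha_i,\beta_i)\ne(0,0)$. A $q$-ary $[[n,k,d]]$ quantum code is a $q^k$-dimensional subspace $Q\subseteq\mathbb{C}^{q^n}$ with minimum distance $d$: it detects every error of weight less than $d$ and fails to detect some error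 of weight $d$, where $Q$ detects $E$ if there is $c\in\mathbb{C}$ with $\langle u|E|v\rangle=c\langle u|v\rangle$ for all $u,v\in Q$. If $k=0$, where this detection condition is void, minimum distance $d$ means instead, as usual, that $\langle u|E|u\rangle=0$ for all $u\in Q$ and all errors $E$ of weight between $1$ and $d-1$, and that $\langle u|E|u\rangle\neq0$ for some $u\in Q$ and some error $E$ of weight $d$. The code is called MDS if it attains the quantum Singleton bound, that is, $2d=n-k+2$. -/

import Mathlib

/-- The Hilbert space `(ℂ^q)^{⊗ n} ≅ ℂ^{q^n}`, with orthonormal basis `|x⟩` indexed by `x ∈ F^n`,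
where `F` is the finite field with `q` elements. -/
abbrev QState (F : Type*) [Fintype F] (n : ℕ) : Type _ := EuclideanSpace ℂ (Fin n → F)

/-- The phase `ζ_p ^ (l + Tr_{F/𝔽_p}(c))`, where `p` is the characteristic of the finite field `F`
and `ζ_p = exp (2πi/p)`. -/
noncomputable def errorPhase (F : Type*) [Field F] [Fintype F] (l : ZMod (ringChar F)) (c : F) :
    ℂ :=
  haveI : NeZero (ringChar F) := ⟨CharP.ringChar_ne_zero_of_finite F⟩
  letI : Algebra (ZMod (ringChar F)) F := ZMod.algebra F (ringChar F)
  ZMod.stdAddChar (l + Algebra.trace (ZMod (ringChar F)) F c)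

/-- The quantum error `ζ_p^l T^a R^b`; it maps `|x⟩` to `ζ_p^(l + Tr(b·x)) |x + a⟩`
(see `quantumError_single`). -/
noncomputable def quantumError {F : Type*} [Field F] [Fintype F] {n : ℕ}
    (l : ZMod (ringChar F)) (a b : Fin n → F) : QState F n →ₗ[ℂ] QState F n where
  toFun ψ := WithLp.toLp 2 fun y => errorPhase F l (b ⬝ᵥ (y - a)) * ψ (y - a)
  map_add' ψ φ := by
    ext y
    simp [mul_add]
  map_smul' c ψ := by
    ext y
    simp [mul_left_comm]

theorem quantumError_single {F : Type*} [Field F] [Fintype F] [DecidableEq F] {n : ℕ}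
    (l : ZMod (ringChar F)) (a b x : Fin n → F) :
    quantumError l a b (EuclideanSpace.single x (1 : ℂ)) =
      errorPhase F l (b ⬝ᵥ x) • EuclideanSpace.single (x + a) (1 : ℂ) := by
  ext y
  by_cases h : y = x + a
  · subst h
    simp [quantumError]
  · have h' : y - a ≠ x := fun e => h (by rw [← e]; simp)
    simp [quantumError, h, h']

/-- The quantum weight of `ζ_p^l T^a R^b`: the number of positions `i` with
`(a_i, b_i) ≠ (0, 0)`. -/
def quantumWeight {F : Type*} [Field F] [DecidableEq F] {n : ℕ} (a b : Fin n → F) : ℕ :=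
  hammingNorm fun i => (a i, b i)

/-- The subspace `Q` detects the error operator `E`: `⟨u|E|v⟩ = c ⟨u|v⟩` on `Q`, for a constant
`c` depending only on `E`. -/
def DetectsError {F : Type*} [Fintype F] {n : ℕ} (Q : Submodule ℂ (QState F n))
    (E : QState F n →ₗ[ℂ] QState F n) : Prop :=
  ∃ c : ℂ, ∀ u ∈ Q, ∀ v ∈ Q, inner ℂ u (E v) = c * inner ℂ u v

/-- The code `Q` has minimum distance `d`. If `dim Q ≠ 1`, it detects all errors of weight less
than `d` but not all errors of weight `d`. A one-dimensional code detects every error, and there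
the usual convention is used: `⟨u|E|u⟩ = 0` on `Q` for all errors `E` of weight between `1` and
`d - 1`, but not for all errors of weight `d`. -/
def HasQuantumMinDist {F : Type*} [Field F] [Fintype F] [DecidableEq F] {n : ℕ}
    (Q : Submodule ℂ (QState F n)) (d : ℕ) : Prop :=
  (Module.finrank ℂ Q ≠ 1 →
    (∀ (l : ZMod (ringChar F)) (a b : Fin n → F), quantumWeight a b < d →
      DetectsError Q (quantumError l a b)) ∧
    ∃ (l : ZMod (ringChar F)) (a b : Fin n → F), quantumWeight a b = d ∧
      ¬ DetectsError Q (quantumError l a b)) ∧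
  (Module.finrank ℂ Q = 1 →
    (∀ (l : ZMod (ringChar F)) (a b : Fin n → F), 0 < quantumWeight a b → quantumWeight a b < d →
      ∀ u ∈ Q, inner ℂ u (quantumError l a b u) = 0) ∧
    ∃ (l : ZMod (ringChar F)) (a b : Fin n → F), quantumWeight a b = d ∧
      ∃ u ∈ Q, inner ℂ u (quantumError l a b u) ≠ 0)

/-- `Q` is a `q`-ary `[[n, k, d]]` quantum code, `q = |F|`: a `q^k`-dimensional subspace of
`ℂ^{q^n}` with minimum distance `d`. -/
def IsQuantumCode {F : Type*} [Field F] [Fintype F] [DecidableEq F] {n : ℕ}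
    (Q : Submodule ℂ (QState F n)) (k d : ℕ) : Prop :=
  Module.finrank ℂ Q = Fintype.card F ^ k ∧ HasQuantumMinDist Q d

/-- An `[[n, k, d]]` quantum code that attains the quantum Singleton bound `2d ≤ n - k + 2`. -/
def IsQuantumMDSCode {F : Type*} [Field F] [Fintype F] [DecidableEq F] {n : ℕ}
    (Q : Submodule ℂ (QState F n)) (k d : ℕ) : Prop :=
  IsQuantumCode Q k d ∧ 2 * (d : ℤ) = (n : ℤ) - (k : ℤ) + 2

/-! Let `K` be the quadratic extension of `F`. A Hermitian self-orthogonal Reed-Solomon code of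
dimension d - 1 over `K` yields commuting Weyl operators on ℂ^(q^n), and their common fixed space is
the quantum code (`exists_isQuantumMDSCode_of_grs`). Its dimension is the trace of the averaging
projection. Its distance is that of the Hermitian dual, or of the code itself when k = 0, and both
codes are MDS.

The arithmetic lies in `exists_points_multipliers`. Let θ have order m(q-1) in `K`. The evaluation
points are the θ^j with m ∤ j, so n = (m-1)(q-1). The multipliers satisfy v^(q+1) = y + y^q with y =
g^(am) θ^(jc) and c = q + 2 - m. This trace vanishes exactly when m ∣ j, so each orthogonality sum
extends to all j mod m(q-1) and splits into two geometric sums. These vanish by `not_dvd_exponent`,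
which is where the upper bound on d enters. -/

open Module

/-! ### Additive character of the finite field -/

section Phase

variable {F : Type*} [Field F] [Fintype F]

theorem errorPhase_add (l l' : ZMod (ringChar F)) (c c' : F) :
    errorPhase F (l + l') (c + c') = errorPhase F l c * errorPhase F l' c' := by
  unfold errorPhase
  simp only [map_add]
  rw [← AddChar.map_add_eq_mul]
  congr 1
  abel

theorem errorPhase_zero_zero : errorPhase F 0 0 = 1 := by
  simp [errorPhase]

theorem norm_errorPhase (l : ZMod (ringChar F)) (c : F) : ‖errorPhase F l c‖ = 1 := by
  have : NeZero (ringChar F) := ⟨CharP.ringChar_ne_zero_of_finite F⟩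
  unfold errorPhase
  rw [ZMod.stdAddChar_apply]
  exact Circle.norm_coe _

theorem errorPhase_ne_zero (l : ZMod (ringChar F)) (c : F) : errorPhase F l c ≠ 0 := by
  rw [← norm_ne_zero_iff, norm_errorPhase]
  exact one_ne_zero

variable (F) in
/-- The canonical additive character `c ↦ ζ_p ^ Tr(c)` of a finite field. -/
noncomputable def phaseChar : AddChar F ℂ where
  toFun := errorPhase F 0
  map_zero_eq_one' := errorPhase_zero_zero
  map_add_eq_mul' x y := by simpa using errorPhase_add (0 : ZMod (ringChar F)) 0 x y

theorem phaseChar_apply (c : F) : phaseChar F c = errorPhase F 0 c := rfl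

theorem errorPhase_eq_mul_phaseChar (l : ZMod (ringChar F)) (c : F) :
    errorPhase F l c = errorPhase F l 0 * phaseChar F c := by
  rw [phaseChar_apply, ← errorPhase_add, add_zero, zero_add]

/-- Nondegeneracy of the trace. It turns a nonzero value of the symplectic form into a nontrivial
phase after rescaling. -/
theorem exists_phaseChar_mul_ne_one {a : F} (ha : a ≠ 0) : ∃ b : F, phaseChar F (b * a) ≠ 1 := by
  have : NeZero (ringChar F) := ⟨CharP.ringChar_ne_zero_of_finite F⟩
  let : Algebra (ZMod (ringChar F)) F := ZMod.algebra F (ringChar F)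
  obtain ⟨b, hb⟩ := FiniteField.trace_to_zmod_nondegenerate F ha
  refine ⟨b, fun h => hb ?_⟩
  rw [mul_comm] at h
  apply ZMod.injective_stdAddChar
  rw [AddChar.map_zero_eq_one, ← h, phaseChar_apply]
  unfold errorPhase
  rw [zero_add]

theorem star_phaseChar_mul_self (c : F) :
    (starRingEnd ℂ) (phaseChar F c) * phaseChar F c = 1 := by
  rw [mul_comm, Complex.mul_conj, Complex.normSq_eq_norm_sq, phaseChar_apply, norm_errorPhase]
  simp

end Phase

/-! ### Weyl operators and their commutation relations -/

section Weyl

variable {F : Type*} [Field F] {n : ℕ}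

/-- The symplectic form on `F^n × F^n`. -/
def sympForm (z w : (Fin n → F) × (Fin n → F)) : F := z.2 ⬝ᵥ w.1 - z.1 ⬝ᵥ w.2

theorem sympForm_swap (z w : (Fin n → F) × (Fin n → F)) : sympForm w z = -sympForm z w := by
  simp only [sympForm, dotProduct_comm w.2, dotProduct_comm w.1, neg_sub]

theorem sympForm_smul_left (c : F) (z w : (Fin n → F) × (Fin n → F)) :
    sympForm (c • z) w = c * sympForm z w := by
  simp [sympForm, mul_sub]

variable [Fintype F]

theorem quantumError_apply (l : ZMod (ringChar F)) (a b : Fin n → F) (v : QState F n)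
    (y : Fin n → F) :
    quantumError l a b v y = errorPhase F l (b ⬝ᵥ (y - a)) * v (y - a) := rfl

theorem quantumError_eq_smul (l : ZMod (ringChar F)) (a b : Fin n → F) :
    quantumError l a b = errorPhase F l 0 • quantumError 0 a b := by
  ext v y
  simp only [LinearMap.smul_apply, PiLp.smul_apply, quantumError_apply, smul_eq_mul]
  rw [errorPhase_eq_mul_phaseChar, phaseChar_apply, mul_assoc]

/-- The Weyl operator of `(a, b)`, that is, `T^a R^b` normalized by the phase of `(a · b) / 2`. -/
noncomputable def weyl (z : (Fin n → F) × (Fin n → F)) : QState F n →ₗ[ℂ] QState F n :=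
  phaseChar F (z.1 ⬝ᵥ z.2 / 2) • quantumError 0 z.1 z.2

theorem weyl_apply (z : (Fin n → F) × (Fin n → F)) (v : QState F n) (y : Fin n → F) :
    weyl z v y = phaseChar F (z.1 ⬝ᵥ z.2 / 2 + z.2 ⬝ᵥ (y - z.1)) * v (y - z.1) := by
  simp only [weyl, LinearMap.smul_apply, PiLp.smul_apply, quantumError_apply, smul_eq_mul]
  rw [AddChar.map_add_eq_mul, ← phaseChar_apply, mul_assoc]

theorem exists_quantumError_eq_smul_weyl (l : ZMod (ringChar F)) (a b : Fin n → F) :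
    ∃ c : ℂ, c ≠ 0 ∧ quantumError l a b = c • weyl (a, b) := by
  refine ⟨errorPhase F l 0 * (phaseChar F (a ⬝ᵥ b / 2))⁻¹, ?_, ?_⟩
  · exact mul_ne_zero (errorPhase_ne_zero _ _) (inv_ne_zero (errorPhase_ne_zero _ _))
  · rw [quantumError_eq_smul, weyl, smul_smul, mul_assoc, inv_mul_cancel₀, mul_one]
    exact errorPhase_ne_zero _ _

theorem weyl_zero : weyl (0 : (Fin n → F) × (Fin n → F)) = 1 := by
  ext v y
  simp [weyl_apply]

/-- The half phase in `weyl` makes the cocycle antisymmetric, so it is trivial on isotropic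
subgroups. Halving is why q must be odd. -/
theorem weyl_mul (h2 : (2 : F) ≠ 0) (z w : (Fin n → F) × (Fin n → F)) :
    weyl z * weyl w = phaseChar F (sympForm z w / 2) • weyl (z + w) := by
  ext v y
  simp only [Module.End.mul_apply, LinearMap.smul_apply, PiLp.smul_apply, smul_eq_mul, weyl_apply,
    Prod.fst_add, Prod.snd_add, sub_sub]
  rw [← mul_assoc, ← mul_assoc, ← AddChar.map_add_eq_mul, ← AddChar.map_add_eq_mul]
  congr 2
  simp only [sympForm, dotProduct_add, add_dotProduct, dotProduct_sub, dotProduct_comm w.1 z.2]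
  field_simp
  ring

theorem weyl_mul_comm (h2 : (2 : F) ≠ 0) (z w : (Fin n → F) × (Fin n → F)) :
    weyl z * weyl w = phaseChar F (sympForm z w) • (weyl w * weyl z) := by
  rw [weyl_mul h2, weyl_mul h2, smul_smul, ← AddChar.map_add_eq_mul, add_comm w z, sympForm_swap]
  congr 2
  field_simp
  ring

theorem inner_weyl_weyl (z : (Fin n → F) × (Fin n → F)) (u v : QState F n) :
    inner ℂ (weyl z u) (weyl z v) = inner ℂ u v := by
  simp only [PiLp.inner_apply, weyl_apply, RCLike.inner_apply, map_mul]
  refine Eq.trans ?_ (Equiv.sum_comp (Equiv.subRight z.1) _)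
  refine Finset.sum_congr rfl fun y _ => ?_
  simp only [Equiv.subRight_apply]
  linear_combination (v (y - z.1) * (starRingEnd ℂ) (u (y - z.1))) *
    star_phaseChar_mul_self (z.1 ⬝ᵥ z.2 / 2 + z.2 ⬝ᵥ (y - z.1))

theorem sum_phaseChar_dotProduct {b : Fin n → F} (hb : b ≠ 0) :
    ∑ y : Fin n → F, phaseChar F (b ⬝ᵥ y) = 0 := by
  classical
  obtain ⟨i, hi⟩ := Function.ne_iff.mp hb
  obtain ⟨c, hc⟩ := exists_phaseChar_mul_ne_one hi
  let χ : AddChar (Fin n → F) ℂ :=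
    { toFun := fun y => phaseChar F (b ⬝ᵥ y)
      map_zero_eq_one' := by simp
      map_add_eq_mul' := fun x y => by rw [dotProduct_add, AddChar.map_add_eq_mul] }
  have hχ : χ ≠ 1 := by
    rw [AddChar.ne_one_iff]
    refine ⟨Pi.single i c, ?_⟩
    change phaseChar F (b ⬝ᵥ Pi.single i c) ≠ 1
    rwa [dotProduct_single, mul_comm]
  exact AddChar.sum_eq_zero_of_ne_one hχ

/-- If the shift part is nonzero, no basis vector maps to a multiple of itself. Otherwise the
operator is diagonal and its entries are the values of a nontrivial character. -/
theorem trace_weyl {z : (Fin n → F) × (Fin n → F)} (hz : z ≠ 0) :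
    LinearMap.trace ℂ _ (weyl z) = 0 := by
  classical
  rw [LinearMap.trace_eq_sum_inner _ (EuclideanSpace.basisFun (Fin n → F) ℂ)]
  simp only [EuclideanSpace.basisFun_apply, EuclideanSpace.inner_single_left, map_one, one_mul,
    weyl_apply]
  by_cases h1 : z.1 = 0
  · have h2 : z.2 ≠ 0 := fun h => hz (Prod.ext h1 h)
    simpa [h1] using sum_phaseChar_dotProduct h2
  · refine Finset.sum_eq_zero fun y _ => ?_
    have : y - z.1 ≠ y := by simpa using h1
    simp [this]

end Weyl

/-! ### Stabilizer codes of isotropic subgroups -/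

section Stabilizer

variable {F : Type*} [Field F] [Fintype F] {n : ℕ}

/-- The stabilizer code of a set of Weyl operators: their common fixed space. -/
noncomputable def stabilizerCode (C : AddSubgroup ((Fin n → F) × (Fin n → F))) :
    Submodule ℂ (QState F n) where
  carrier := {v | ∀ z ∈ C, weyl z v = v}
  add_mem' hu hv z hz := by rw [map_add, hu z hz, hv z hz]
  zero_mem' z _ := map_zero _
  smul_mem' c v hv z hz := by rw [map_smul, hv z hz]

open Classical in
/-- The average of the Weyl operators of `C`. -/
noncomputable def stabilizerProj (C : AddSubgroup ((Fin n → F) × (Fin n → F))) :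
    QState F n →ₗ[ℂ] QState F n :=
  (Nat.card C : ℂ)⁻¹ • ∑ z : C, weyl (z : (Fin n → F) × (Fin n → F))

variable {C : AddSubgroup ((Fin n → F) × (Fin n → F))}

theorem weyl_mul_of_mem (h2 : (2 : F) ≠ 0) (hC : ∀ z ∈ C, ∀ w ∈ C, sympForm z w = 0)
    {z w : (Fin n → F) × (Fin n → F)} (hz : z ∈ C) (hw : w ∈ C) :
    weyl z * weyl w = weyl (z + w) := by
  rw [weyl_mul h2, hC z hz w hw, zero_div, AddChar.map_zero_eq_one, one_smul]

theorem isProj_stabilizerProj (h2 : (2 : F) ≠ 0) (hC : ∀ z ∈ C, ∀ w ∈ C, sympForm z w = 0) :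
    LinearMap.IsProj (stabilizerCode C) (stabilizerProj C) := by
  classical
  constructor
  · intro v z hz
    simp only [stabilizerProj, LinearMap.smul_apply, map_smul, LinearMap.sum_apply, map_sum]
    congr 1
    refine Eq.trans ?_ (Equiv.sum_comp (Equiv.addLeft (⟨z, hz⟩ : C)) _)
    refine Finset.sum_congr rfl fun w _ => ?_
    rw [← Module.End.mul_apply, weyl_mul_of_mem h2 hC hz w.2]
    rfl
  · intro v hv
    have h : ∀ z : C, weyl (z : (Fin n → F) × (Fin n → F)) v = v := fun z => hv z z.2
    have hcard : (Nat.card C : ℂ) ≠ 0 := Nat.cast_ne_zero.mpr Nat.card_pos.ne'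
    simp only [stabilizerProj, LinearMap.smul_apply, LinearMap.sum_apply, h, Finset.sum_const,
      Finset.card_univ, ← Nat.card_eq_fintype_card]
    rw [← Nat.cast_smul_eq_nsmul ℂ, smul_smul, inv_mul_cancel₀ hcard, one_smul]

/-- The rank of a projection is its trace, and only the identity contributes to the trace of the
average. -/
theorem finrank_stabilizerCode (h2 : (2 : F) ≠ 0) (hC : ∀ z ∈ C, ∀ w ∈ C, sympForm z w = 0) :
    finrank ℂ (stabilizerCode C) * Nat.card C = Fintype.card F ^ n := by
  classical
  have hcard : (Nat.card C : ℂ) ≠ 0 := Nat.cast_ne_zero.mpr Nat.card_pos.ne'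
  have h := (isProj_stabilizerProj h2 hC).trace
  have hs : ∑ z : C, LinearMap.trace ℂ _ (weyl (z : (Fin n → F) × (Fin n → F))) =
      (Fintype.card F ^ n : ℕ) := by
    rw [Finset.sum_eq_single (0 : C)]
    · rw [AddSubgroup.coe_zero, weyl_zero, LinearMap.trace_one]
      simp
    · intro z _ hz
      exact trace_weyl (by simpa using hz)
    · simp
  rw [stabilizerProj, map_smul, map_sum, hs, smul_eq_mul] at h
  have h' : ((finrank ℂ (stabilizerCode C) * Nat.card C : ℕ) : ℂ) =
      ((Fintype.card F ^ n : ℕ) : ℂ) := by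
    rw [Nat.cast_mul, ← h]
    field_simp
  exact_mod_cast h'

/-- The unitary `weyl z` fixes `u` and `v` but multiplies `weyl e v` by a nontrivial phase, so the
inner product equals a nontrivial multiple of itself. -/
theorem inner_weyl_eq_zero (h2 : (2 : F) ≠ 0) {e z : (Fin n → F) × (Fin n → F)} (hz : z ∈ C)
    (h : phaseChar F (sympForm z e) ≠ 1) {u v : QState F n} (hu : u ∈ stabilizerCode C)
    (hv : v ∈ stabilizerCode C) : inner ℂ u (weyl e v) = 0 := by
  have h1 : weyl z (weyl e v) = phaseChar F (sympForm z e) • weyl e v := by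
    rw [← Module.End.mul_apply, weyl_mul_comm h2, LinearMap.smul_apply, Module.End.mul_apply,
      hv z hz]
  have h3 : inner ℂ u (weyl e v) = phaseChar F (sympForm z e) * inner ℂ u (weyl e v) := by
    conv_lhs => rw [← inner_weyl_weyl z, hu z hz, h1, inner_smul_right]
  have h4 : (1 - phaseChar F (sympForm z e)) * inner ℂ u (weyl e v) = 0 := by
    linear_combination h3
  exact (mul_eq_zero.mp h4).resolve_left (sub_ne_zero.mpr (Ne.symm h))

/-- Commuting with the stabilizer, `weyl e` preserves the code, so detection would make it a scalar
`c` there. But `weyl e` times the projection has trace zero, because `e + z ≠ 0` for every `z ∈ C`.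
This forces `c = 0`, against unitarity. -/
theorem not_detectsError_weyl (h2 : (2 : F) ≠ 0) (hC : ∀ z ∈ C, ∀ w ∈ C, sympForm z w = 0)
    {e : (Fin n → F) × (Fin n → F)} (he : ∀ z ∈ C, sympForm z e = 0) (heC : e ∉ C) :
    ¬ DetectsError (stabilizerCode C) (weyl e) := by
  classical
  rintro ⟨c, hc⟩
  have hmem : ∀ v ∈ stabilizerCode C, weyl e v ∈ stabilizerCode C := by
    intro v hv z hz
    rw [← Module.End.mul_apply, weyl_mul_comm h2, he z hz, AddChar.map_zero_eq_one, one_smul,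
      Module.End.mul_apply, hv z hz]
  have hsmul : ∀ v ∈ stabilizerCode C, weyl e v = c • v := by
    intro v hv
    have hd : weyl e v - c • v ∈ stabilizerCode C :=
      Submodule.sub_mem _ (hmem v hv) (Submodule.smul_mem _ _ hv)
    have h0 : inner ℂ (weyl e v - c • v) (weyl e v - c • v) = (0 : ℂ) := by
      rw [inner_sub_right, hc _ hd v hv, inner_smul_right, sub_self]
    exact sub_eq_zero.mp (inner_self_eq_zero.mp h0)
  have hproj := isProj_stabilizerProj h2 hC
  have hcomp : weyl e * stabilizerProj C = c • stabilizerProj C := by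
    ext1 v
    exact hsmul _ (hproj.map_mem v)
  have htr : LinearMap.trace ℂ _ (weyl e * stabilizerProj C) = 0 := by
    rw [stabilizerProj, mul_smul_comm, Finset.mul_sum, map_smul, map_sum, Finset.sum_eq_zero,
      smul_zero]
    intro z _
    rw [weyl_mul h2, map_smul, trace_weyl, smul_zero]
    intro h0
    exact heC (by rw [eq_neg_of_add_eq_zero_left h0]; exact C.neg_mem z.2)
  have hfin := finrank_stabilizerCode h2 hC
  have hpos : finrank ℂ (stabilizerCode C) ≠ 0 := by
    intro h0
    rw [h0, zero_mul] at hfin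
    exact pow_ne_zero n Fintype.card_ne_zero hfin.symm
  rw [hcomp, map_smul, hproj.trace, smul_eq_mul, mul_eq_zero, Nat.cast_eq_zero] at htr
  have hc0 : c = 0 := htr.resolve_right hpos
  have : Nontrivial (stabilizerCode C) :=
    Module.nontrivial_of_finrank_pos (R := ℂ) (Nat.pos_of_ne_zero hpos)
  obtain ⟨⟨v, hv⟩, hv0⟩ := exists_ne (0 : stabilizerCode C)
  apply hv0
  have h1 := inner_weyl_weyl e v v
  rw [hsmul v hv, hc0, zero_smul, inner_zero_left] at h1
  exact Subtype.ext (inner_self_eq_zero.mp h1.symm)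

end Stabilizer

open Polynomial

/-! ### From the Hermitian form over `K` to the symplectic form over `F` -/

section QuadraticExtension

variable {F K : Type*} [Field K] {n : ℕ}

/-- The Hermitian form `∑ x_i y_i ^ q` on `K^n`, where `F` has `q` elements. -/
def hermForm (F : Type*) [Fintype F] {K : Type*} [Field K] {n : ℕ} (x y : Fin n → K) : K :=
  ∑ i, x i * y i ^ Fintype.card F

theorem hermForm_smul_left [Fintype F] (c : K) (x y : Fin n → K) :
    hermForm F (c • x) y = c * hermForm F x y := by
  simp [hermForm, Finset.mul_sum, mul_assoc]

theorem pow_card_pow_card [Fintype F] [Fintype K] (hK : Fintype.card K = Fintype.card F ^ 2) (x : K) :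
    (x ^ Fintype.card F) ^ Fintype.card F = x := by
  rw [← pow_mul, ← sq, ← hK, FiniteField.pow_card]

theorem exists_pow_fintypeCard_ne [Field F] [Fintype F] [Fintype K] (hK : Fintype.card K = Fintype.card F ^ 2) :
    ∃ ω : K, ω ^ Fintype.card F ≠ ω := by
  classical
  by_contra! h
  have hq : 1 < Fintype.card F := Fintype.one_lt_card
  have hcard : Fintype.card K ≤ Fintype.card F := by
    have hne := FiniteField.X_pow_card_sub_X_ne_zero K hq
    calc Fintype.card K = (Finset.univ : Finset K).card := Finset.card_univ.symm
      _ ≤ (X ^ Fintype.card F - X : K[X]).roots.toFinset.card :=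
        Finset.card_le_card fun x _ => by simp [hne, h x]
      _ ≤ Multiset.card (X ^ Fintype.card F - X : K[X]).roots := Multiset.toFinset_card_le _
      _ ≤ (X ^ Fintype.card F - X : K[X]).natDegree := card_roots' _
      _ = Fintype.card F := FiniteField.X_pow_card_sub_X_natDegree_eq K hq
  rw [hK] at hcard
  nlinarith

variable [Field F] [Algebra F K]

/-- The identification of `F^n × F^n` with `K^n` given by the basis `1, ω` of `K`. -/
def pairToExt (F : Type*) [Field F] {K : Type*} [Field K] [Algebra F K] (n : ℕ) (ω : K) :
    ((Fin n → F) × (Fin n → F)) →ₗ[F] (Fin n → K) where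
  toFun z i := algebraMap F K (z.1 i) + algebraMap F K (z.2 i) * ω
  map_add' z w := by
    ext i
    simp only [Prod.fst_add, Prod.snd_add, Pi.add_apply, map_add]
    ring
  map_smul' c z := by
    ext i
    simp only [Prod.smul_fst, Prod.smul_snd, Pi.smul_apply, smul_eq_mul, map_mul,
      RingHom.id_apply]
    rw [Algebra.smul_def]
    ring

theorem pairToExt_apply (ω : K) (z : (Fin n → F) × (Fin n → F)) (i : Fin n) :
    pairToExt F n ω z i = algebraMap F K (z.1 i) + algebraMap F K (z.2 i) * ω := rfl

/-- The elements of `F^n × F^n` that correspond to a `K`-linear code in `K^n`. -/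
def symplecticCode (F : Type*) [Field F] {K : Type*} [Field K] [Algebra F K] {n : ℕ} (ω : K)
    (D : Submodule K (Fin n → K)) : AddSubgroup ((Fin n → F) × (Fin n → F)) :=
  D.toAddSubgroup.comap (pairToExt F n ω).toAddMonoidHom

theorem mem_symplecticCode {ω : K} {D : Submodule K (Fin n → K)}
    {z : (Fin n → F) × (Fin n → F)} : z ∈ symplecticCode F ω D ↔ pairToExt F n ω z ∈ D := Iff.rfl

variable [Fintype F]

theorem add_pow_fintypeCard (x y : K) :
    (x + y) ^ Fintype.card F = x ^ Fintype.card F + y ^ Fintype.card F := by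
  simpa using map_add (FiniteField.frobeniusAlgHom F K) x y

theorem sum_pow_fintypeCard {ι : Type*} (s : Finset ι) (f : ι → K) :
    (∑ i ∈ s, f i) ^ Fintype.card F = ∑ i ∈ s, f i ^ Fintype.card F := by
  simpa only [FiniteField.frobeniusAlgHom_apply] using
    map_sum (FiniteField.frobeniusAlgHom F K) f s

theorem algebraMap_pow_fintypeCard (x : F) :
    algebraMap F K x ^ Fintype.card F = algebraMap F K x := by
  rw [← map_pow, FiniteField.pow_card]

theorem coord_eq_zero {ω : K} (hω : ω ^ Fintype.card F ≠ ω) {a b : F}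
    (h : algebraMap F K a + algebraMap F K b * ω = 0) : a = 0 ∧ b = 0 := by
  have h1 : algebraMap F K a + algebraMap F K b * ω ^ Fintype.card F = 0 := by
    have := congrArg (· ^ Fintype.card F) h
    simpa [add_pow_fintypeCard, mul_pow, algebraMap_pow_fintypeCard] using this
  have h2 : algebraMap F K b * (ω ^ Fintype.card F - ω) = 0 := by linear_combination h1 - h
  have h3 : algebraMap F K b = 0 := (mul_eq_zero.mp h2).resolve_right (sub_ne_zero.mpr hω)
  rw [h3, zero_mul, add_zero] at h
  simpa using And.intro h h3

theorem pairToExt_bijective [Fintype K] (hK : Fintype.card K = Fintype.card F ^ 2) {ω : K}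
    (hω : ω ^ Fintype.card F ≠ ω) : Function.Bijective (pairToExt F n ω) := by
  classical
  rw [Fintype.bijective_iff_injective_and_card]
  constructor
  · rw [injective_iff_map_eq_zero]
    intro z hz
    have h : ∀ i, z.1 i = 0 ∧ z.2 i = 0 := fun i => coord_eq_zero hω (congrFun hz i)
    exact Prod.ext (funext fun i => (h i).1) (funext fun i => (h i).2)
  · simp only [Fintype.card_prod, Fintype.card_fun, Fintype.card_fin, hK]
    ring

theorem hammingNorm_pairToExt [DecidableEq F] [DecidableEq K] {ω : K}
    (hω : ω ^ Fintype.card F ≠ ω) (z : (Fin n → F) × (Fin n → F)) :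
    hammingNorm (pairToExt F n ω z) = quantumWeight z.1 z.2 := by
  unfold quantumWeight hammingNorm
  congr 1
  ext i
  rw [Finset.mem_filter_univ, Finset.mem_filter_univ, pairToExt_apply, ne_eq, ne_eq,
    Prod.mk_eq_zero]
  refine not_congr ⟨coord_eq_zero hω, ?_⟩
  rintro ⟨h1, h2⟩
  simp [h1, h2]

/-- The Hermitian form minus its conjugate is a nonzero multiple of the symplectic form when `ω` is
not in `F`. This links the two notions of orthogonality. -/
theorem hermForm_pairToExt_sub (ω : K) (z w : (Fin n → F) × (Fin n → F)) :
    hermForm F (pairToExt F n ω z) (pairToExt F n ω w) -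
      hermForm F (pairToExt F n ω w) (pairToExt F n ω z) =
      (ω - ω ^ Fintype.card F) * algebraMap F K (sympForm z w) := by
  simp only [hermForm, sympForm, dotProduct, map_sub, map_sum, map_mul, pairToExt_apply,
    ← Finset.sum_sub_distrib, Finset.mul_sum]
  refine Finset.sum_congr rfl fun i _ => ?_
  simp only [add_pow_fintypeCard, mul_pow, algebraMap_pow_fintypeCard]
  ring

theorem hermForm_swap [Fintype K] (hK : Fintype.card K = Fintype.card F ^ 2) (x y : Fin n → K) :
    hermForm F y x = hermForm F x y ^ Fintype.card F := by
  simp only [hermForm, sum_pow_fintypeCard, mul_pow, pow_card_pow_card hK]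
  exact Finset.sum_congr rfl fun i _ => mul_comm _ _

theorem sympForm_eq_zero_of_hermForm [Fintype K] (hK : Fintype.card K = Fintype.card F ^ 2) {ω : K}
    (hω : ω ^ Fintype.card F ≠ ω) {z w : (Fin n → F) × (Fin n → F)}
    (h : hermForm F (pairToExt F n ω z) (pairToExt F n ω w) = 0) : sympForm z w = 0 := by
  have h1 := hermForm_pairToExt_sub ω z w
  rw [hermForm_swap hK (pairToExt F n ω z), h, zero_pow Fintype.card_ne_zero, sub_zero] at h1
  simpa [sub_eq_zero, hω.symm] using h1

/-- Symplectic orthogonality only says that the Hermitian value is fixed by conjugation. As `D` is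
`K`-linear, the same holds for `ω` times that value, which forces it to be zero. -/
theorem hermForm_eq_zero_of_sympForm [Fintype K] (hK : Fintype.card K = Fintype.card F ^ 2) {ω : K}
    (hω : ω ^ Fintype.card F ≠ ω) {D : Submodule K (Fin n → K)} {e : (Fin n → F) × (Fin n → F)}
    (h : ∀ z ∈ symplecticCode F ω D, sympForm z e = 0) {y : Fin n → K} (hy : y ∈ D) :
    hermForm F y (pairToExt F n ω e) = 0 := by
  have key : ∀ y ∈ D, hermForm F y (pairToExt F n ω e) =
      hermForm F y (pairToExt F n ω e) ^ Fintype.card F := by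
    intro y hy
    obtain ⟨z, rfl⟩ := (pairToExt_bijective hK hω).2 y
    have h1 := hermForm_pairToExt_sub ω z e
    rw [h z hy, map_zero, mul_zero, hermForm_swap hK (pairToExt F n ω z), sub_eq_zero] at h1
    exact h1
  have h1 := key y hy
  have h2 := key (ω • y) (D.smul_mem ω hy)
  rw [hermForm_smul_left, mul_pow, ← h1] at h2
  have h3 : (ω - ω ^ Fintype.card F) * hermForm F y (pairToExt F n ω e) = 0 := by
    linear_combination h2
  exact (mul_eq_zero.mp h3).resolve_left (sub_ne_zero.mpr hω.symm)

end QuadraticExtension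

/-! ### Generalized Reed-Solomon codes and their Hermitian duals -/

section GRS

variable {K : Type*} [Field K] {n : ℕ}

/-- The encoding map of the generalized Reed-Solomon code with evaluation points `α`, column
multipliers `v` and dimension `r`. -/
noncomputable def grsMap (α v : Fin n → K) (r : ℕ) : degreeLT K r →ₗ[K] (Fin n → K) where
  toFun p i := v i * (p : K[X]).eval (α i)
  map_add' p p' := by
    ext i
    simp [mul_add]
  map_smul' c p := by
    ext i
    simp [mul_left_comm]

/-- The generalized Reed-Solomon code. -/
noncomputable def grsCode (α v : Fin n → K) (r : ℕ) : Submodule K (Fin n → K) :=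
  LinearMap.range (grsMap α v r)

variable {α v : Fin n → K} {r : ℕ}

theorem grsMap_apply (p : degreeLT K r) (i : Fin n) :
    grsMap α v r p i = v i * (p : K[X]).eval (α i) := rfl

theorem exists_of_mem_grsCode {y : Fin n → K} (hy : y ∈ grsCode α v r) :
    ∃ p : K[X], p.degree < r ∧ ∀ i, y i = v i * p.eval (α i) := by
  obtain ⟨p, rfl⟩ := hy
  exact ⟨p, mem_degreeLT.mp p.2, fun i => rfl⟩

theorem mem_grsCode {p : K[X]} (hp : p.degree < r) :
    (fun i => v i * p.eval (α i)) ∈ grsCode α v r :=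
  ⟨⟨p, mem_degreeLT.mpr hp⟩, rfl⟩

theorem eq_zero_of_mem_grsCode [DecidableEq K] (hα : Function.Injective α) (hv : ∀ i, v i ≠ 0)
    {y : Fin n → K} (hy : y ∈ grsCode α v r) (h : hammingNorm y + r ≤ n) : y = 0 := by
  obtain ⟨p, hp, hpy⟩ := exists_of_mem_grsCode hy
  have hcard : r ≤ (Finset.univ.filter fun i => y i = 0).card := by
    have h1 := Finset.card_filter_add_card_filter_not (s := (Finset.univ : Finset (Fin n)))
      (fun i => y i = 0)
    rw [Finset.card_univ, Fintype.card_fin] at h1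
    have h2 : hammingNorm y = (Finset.univ.filter fun i => ¬ y i = 0).card := rfl
    omega
  have hp0 : p = 0 := by
    refine eq_zero_of_degree_lt_of_eval_index_eq_zero _ hα.injOn
      (hp.trans_le (Nat.cast_le.mpr hcard)) fun i hi => ?_
    have := hpy i
    rw [(Finset.mem_filter.mp hi).2] at this
    exact (mul_eq_zero.mp this.symm).resolve_left (hv i)
  ext i
  simp [hpy, hp0]

theorem natCard_grsCode [Fintype K] (hα : Function.Injective α) (hv : ∀ i, v i ≠ 0) (hr : r ≤ n) :
    Nat.card (grsCode α v r) = Fintype.card K ^ r := by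
  have hinj : Function.Injective (grsMap α v r) := by
    rw [injective_iff_map_eq_zero]
    intro p hp
    refine Subtype.ext (eq_zero_of_degree_lt_of_eval_index_eq_zero Finset.univ hα.injOn ?_
      fun i _ => ?_)
    · rw [Finset.card_univ, Fintype.card_fin]
      exact (mem_degreeLT.mp p.2).trans_le (Nat.cast_le.mpr hr)
    · have := congrFun hp i
      rw [grsMap_apply, Pi.zero_apply] at this
      exact (mul_eq_zero.mp this).resolve_left (hv i)
  rw [grsCode, ← Nat.card_congr (LinearEquiv.ofInjective _ hinj).toEquiv,
    Nat.card_congr (degreeLTEquiv K r).toEquiv]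
  simp

theorem degree_prod_X_sub_C_index {ι : Type*} (s : Finset ι) (β : ι → K) :
    (∏ i ∈ s, (X - C (β i))).degree = (s.card : WithBot ℕ) := by
  rw [degree_prod]
  simp

theorem exists_mem_grsCode_hammingNorm_eq [DecidableEq K] (hα : Function.Injective α)
    (hv : ∀ i, v i ≠ 0) (hr : 1 ≤ r) (hrn : r ≤ n) :
    ∃ y ∈ grsCode α v r, hammingNorm y = n - r + 1 := by
  obtain ⟨S, -, hS⟩ := Finset.exists_subset_card_eq (s := (Finset.univ : Finset (Fin n)))
    (n := r - 1) (by simp; omega)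
  refine ⟨_, mem_grsCode (p := ∏ i ∈ S, (X - C (α i))) ?_, ?_⟩
  · rw [degree_prod_X_sub_C_index, hS]
    exact_mod_cast (by omega : r - 1 < r)
  · have : (Finset.univ.filter fun i => v i * (∏ j ∈ S, (X - C (α j))).eval (α i) ≠ 0) = Sᶜ := by
      ext i
      simp [hv i, eval_prod, Finset.prod_eq_zero_iff, sub_eq_zero, hα.eq_iff]
    rw [hammingNorm, this, Finset.card_compl, hS, Fintype.card_fin]
    omega

variable {F : Type*} [Fintype F]

/-- Pair `e` with the codeword of the polynomial that vanishes on the whole support of `e` except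
one point: a single nonzero term survives. -/
theorem eq_zero_of_hermForm_grsCode [DecidableEq K] [Nonempty F] (hα : Function.Injective α)
    (hv : ∀ i, v i ≠ 0) {e : Fin n → K} (he : ∀ y ∈ grsCode α v r, hermForm F y e = 0)
    (hw : hammingNorm e ≤ r) : e = 0 := by
  by_contra hne
  obtain ⟨i₀, hi₀⟩ := Function.ne_iff.mp hne
  have hmem : i₀ ∈ Finset.univ.filter fun i => e i ≠ 0 := by simpa using hi₀
  set S := (Finset.univ.filter fun i => e i ≠ 0).erase i₀ with hS
  have hScard : S.card < r := by
    have h1 := Finset.card_erase_add_one hmem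
    have h2 : hammingNorm e = (Finset.univ.filter fun i => e i ≠ 0).card := rfl
    rw [← hS] at h1
    omega
  have h := he _ (mem_grsCode (p := ∏ i ∈ S, (X - C (α i)))
    (by rw [degree_prod_X_sub_C_index]; exact_mod_cast hScard))
  rw [hermForm, Finset.sum_eq_single i₀ _ (by simp)] at h
  · have h1 : (∏ i ∈ S, (X - C (α i))).eval (α i₀) ≠ 0 := by
      simp only [eval_prod, eval_sub, eval_X, eval_C, Finset.prod_ne_zero_iff, sub_ne_zero]
      intro j hj hji
      rw [← hα hji] at hj
      simp [hS] at hj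
    exact mul_ne_zero (mul_ne_zero (hv i₀) h1) (pow_ne_zero _ hi₀) h
  · intro j _ hj
    by_cases hej : e j = 0
    · rw [hej, zero_pow Fintype.card_ne_zero, mul_zero]
    · have hjS : j ∈ S := by simp [hS, hj, hej]
      rw [eval_prod, Finset.prod_eq_zero hjS (by simp), mul_zero, zero_mul]

theorem hermForm_eq_sum_of_degree_lt {p : K[X]} (hp : p.degree < r) (e : Fin n → K) :
    hermForm F (fun i => v i * p.eval (α i)) e =
      ∑ j : Fin r, p.coeff j * ∑ i, e i ^ Fintype.card F * v i * α i ^ (j : ℕ) := by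
  simp only [hermForm, Finset.mul_sum]
  rw [Finset.sum_comm]
  refine Finset.sum_congr rfl fun i _ => ?_
  rw [eval_eq_sum_degreeLTEquiv (mem_degreeLT.mpr hp), Finset.mul_sum, Finset.sum_mul]
  refine Finset.sum_congr rfl fun j _ => ?_
  simp only [degreeLTEquiv, LinearEquiv.coe_mk, LinearMap.coe_mk, AddHom.coe_mk]
  ring

/-- On r + 1 coordinates the r parity checks have a nonzero solution, and the dual distance bound
prevents a smaller weight. -/
theorem exists_hermForm_grsCode_hammingNorm_eq [DecidableEq K] [Fintype K] [Nonempty F]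
    (hK : Fintype.card K = Fintype.card F ^ 2) (hα : Function.Injective α) (hv : ∀ i, v i ≠ 0)
    (hrn : r + 1 ≤ n) :
    ∃ e : Fin n → K, (∀ y ∈ grsCode α v r, hermForm F y e = 0) ∧ hammingNorm e = r + 1 := by
  obtain ⟨S, -, hS⟩ := Finset.exists_subset_card_eq (s := (Finset.univ : Finset (Fin n)))
    (n := r + 1) (by simpa using hrn)
  let T : (S → K) →ₗ[K] (Fin r → K) :=
    { toFun := fun g j => ∑ i : S, g i * v i * α i ^ (j : ℕ)
      map_add' := fun g g' => by
        ext j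
        simp [add_mul, Finset.sum_add_distrib]
      map_smul' := fun c g => by
        ext j
        simp [Finset.mul_sum, mul_assoc] }
  have hker : LinearMap.ker T ≠ ⊥ := LinearMap.ker_ne_bot_of_finrank_lt (by simp [hS])
  obtain ⟨g, hg, hg0⟩ := Submodule.exists_mem_ne_zero_of_ne_bot hker
  have hq : Fintype.card F ≠ 0 := Fintype.card_ne_zero
  -- The checks are linear in the conjugate of `e`, so `e` is the conjugate of the solution `g`.
  let e : Fin n → K := fun i => if h : i ∈ S then g ⟨i, h⟩ ^ Fintype.card F else 0
  have heS : ∀ i : S, e i ^ Fintype.card F = g i := by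
    intro i
    simp only [e, i.2, dite_true]
    rw [← pow_mul, ← sq, ← hK, FiniteField.pow_card]
  have he : ∀ y ∈ grsCode α v r, hermForm F y e = 0 := by
    intro y hy
    obtain ⟨p, hp, hpy⟩ := exists_of_mem_grsCode hy
    rw [show y = fun i => v i * p.eval (α i) from funext hpy, hermForm_eq_sum_of_degree_lt hp]
    refine Finset.sum_eq_zero fun j _ => ?_
    have hj := congrFun (LinearMap.mem_ker.mp hg) j
    change ∑ i : S, g i * v i * α i ^ (j : ℕ) = 0 at hj
    rw [← Finset.sum_subset (Finset.subset_univ S), ← Finset.sum_coe_sort S]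
    · simp only [heS, hj, mul_zero]
    · intro i _ hi
      simp [e, hi, hq]
  refine ⟨e, he, le_antisymm ?_ ?_⟩
  · rw [← hS]
    refine Finset.card_le_card fun i hi => ?_
    by_contra hiS
    simp [e, hiS] at hi
  · by_contra! hlt
    have h0 := eq_zero_of_hermForm_grsCode (F := F) hα hv he (Nat.lt_succ_iff.mp hlt)
    apply hg0
    ext i
    rw [← heS i, h0, Pi.zero_apply, zero_pow hq, Pi.zero_apply]

end GRS

/-! ### Quantum MDS codes from Hermitian self-orthogonal Reed-Solomon codes -/

section Bridge

variable {F K : Type*} [Field F] [Fintype F] [Field K] [Algebra F K] {n r : ℕ} {α v : Fin n → K}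

/-- By sesquilinearity it suffices to pair the monomials of degrees `s` and `t`. -/
theorem hermForm_grsCode_eq_zero
    (h : ∀ s < r, ∀ t < r, ∑ i, v i ^ (Fintype.card F + 1) * α i ^ (s + Fintype.card F * t) = 0)
    {x y : Fin n → K} (hx : x ∈ grsCode α v r) (hy : y ∈ grsCode α v r) : hermForm F x y = 0 := by
  obtain ⟨p, hp, hpx⟩ := exists_of_mem_grsCode hx
  obtain ⟨p', hp', hpy⟩ := exists_of_mem_grsCode hy
  rw [show x = fun i => v i * p.eval (α i) from funext hpx, hermForm_eq_sum_of_degree_lt hp]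
  refine Finset.sum_eq_zero fun s _ => ?_
  have h1 : ∑ i, y i ^ Fintype.card F * v i * α i ^ (s : ℕ) =
      ∑ t : Fin r, p'.coeff t ^ Fintype.card F *
        ∑ i, v i ^ (Fintype.card F + 1) * α i ^ (s + Fintype.card F * t) := by
    simp only [Finset.mul_sum]
    rw [Finset.sum_comm]
    refine Finset.sum_congr rfl fun i _ => ?_
    rw [hpy, eval_eq_sum_degreeLTEquiv (mem_degreeLT.mpr hp'), mul_pow, sum_pow_fintypeCard,
      Finset.mul_sum, Finset.sum_mul, Finset.sum_mul]
    refine Finset.sum_congr rfl fun t _ => ?_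
    simp only [degreeLTEquiv, LinearEquiv.coe_mk, LinearMap.coe_mk, AddHom.coe_mk]
    ring
  rw [h1, Finset.sum_eq_zero, mul_zero]
  intro t _
  rw [h s s.2 t t.2, mul_zero]

theorem exists_isQuantumMDSCode_of_grs [DecidableEq F] [Fintype K] (hodd : (2 : F) ≠ 0)
    (hK : Fintype.card K = Fintype.card F ^ 2) (hα : Function.Injective α) (hv : ∀ i, v i ≠ 0)
    (hr : 1 ≤ r) (hrn : 2 * r ≤ n)
    (h : ∀ s < r, ∀ t < r, ∑ i, v i ^ (Fintype.card F + 1) * α i ^ (s + Fintype.card F * t) = 0) :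
    ∃ Q : Submodule ℂ (QState F n), IsQuantumMDSCode Q (n - 2 * r) (r + 1) := by
  classical
  obtain ⟨ω, hω⟩ := exists_pow_fintypeCard_ne hK
  have hbij := pairToExt_bijective (n := n) hK hω
  set D := grsCode α v r with hD
  set S := symplecticCode F ω D with hSdef
  have hiso : ∀ z ∈ S, ∀ w ∈ S, sympForm z w = 0 := fun z hz w hw =>
    sympForm_eq_zero_of_hermForm hK hω (hermForm_grsCode_eq_zero h hz hw)
  have hcardS : Nat.card S = Fintype.card F ^ (2 * r) := by
    have e : S ≃ D := (Equiv.ofBijective _ hbij).subtypeEquiv fun z => Iff.rfl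
    rw [Nat.card_congr e, natCard_grsCode hα hv (by omega), hK, pow_mul]
  have hq : 1 < Fintype.card F := Fintype.one_lt_card
  have hdim : finrank ℂ (stabilizerCode S) = Fintype.card F ^ (n - 2 * r) := by
    have h1 := finrank_stabilizerCode hodd hiso
    rw [hcardS] at h1
    refine Nat.eq_of_mul_eq_mul_right (pow_pos (by omega : 0 < Fintype.card F) (2 * r)) ?_
    rw [h1, ← pow_add]
    congr 1
    omega
  have hsmall : ∀ a b : Fin n → F, (a, b) ≠ 0 → quantumWeight a b < r + 1 →
      ∀ u ∈ stabilizerCode S, ∀ w ∈ stabilizerCode S, inner ℂ u (weyl (a, b) w) = 0 := by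
    intro a b hne hwt u hu w hw
    obtain ⟨z, hz, hze⟩ : ∃ z ∈ S, sympForm z (a, b) ≠ 0 := by
      by_contra! hall
      have h0 := eq_zero_of_hermForm_grsCode (F := F) hα hv
        (fun y hy => hermForm_eq_zero_of_sympForm hK hω hall hy)
        (by rw [hammingNorm_pairToExt hω]; exact Nat.lt_succ_iff.mp hwt)
      exact hne (hbij.1 (h0.trans (map_zero _).symm))
    -- A nonzero form value may still have trivial phase. As `S` is closed under scaling by `F`, `z`
    -- can be replaced by a multiple.
    obtain ⟨c, hc⟩ := exists_phaseChar_mul_ne_one hze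
    refine inner_weyl_eq_zero hodd (z := c • z) ?_ ?_ hu hw
    · rw [hSdef, mem_symplecticCode, map_smul, ← algebraMap_smul K c]
      exact D.smul_mem _ hz
    · rwa [sympForm_smul_left]
  refine ⟨stabilizerCode S, ⟨hdim, fun hne => ⟨?_, ?_⟩, fun heq => ⟨?_, ?_⟩⟩, by omega⟩
  · intro l a b hwt
    obtain ⟨c, -, hc⟩ := exists_quantumError_eq_smul_weyl l a b
    rw [hc]
    by_cases h0 : (a, b) = 0
    · refine ⟨c, fun u _ w _ => ?_⟩
      rw [h0, weyl_zero, LinearMap.smul_apply, Module.End.one_apply, inner_smul_right]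
    · refine ⟨0, fun u hu w hw => ?_⟩
      rw [LinearMap.smul_apply, inner_smul_right, hsmall a b h0 hwt u hu w hw, mul_zero, zero_mul]
  -- For k > 0 the undetected error is a dual word of weight r + 1. It is not in `D`, whose nonzero
  -- words have weight at least n - r + 1 > r + 1.
  · have hlt : 2 * r < n := by
      rcases hrn.lt_or_eq with hlt | heq
      · exact hlt
      · rw [hdim, heq, Nat.sub_self, pow_zero] at hne
        exact absurd rfl hne
    obtain ⟨x, hx, hxw⟩ := exists_hermForm_grsCode_hammingNorm_eq (F := F) (r := r) hK hα hv
      (by omega)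
    obtain ⟨e, rfl⟩ := hbij.2 x
    obtain ⟨c, hc0, hc⟩ := exists_quantumError_eq_smul_weyl 0 e.1 e.2
    refine ⟨0, e.1, e.2, by rw [← hammingNorm_pairToExt hω, hxw], ?_⟩
    rintro ⟨c', hc'⟩
    refine not_detectsError_weyl hodd hiso (e := e)
      (fun z hz => sympForm_eq_zero_of_hermForm hK hω (hx _ hz)) (fun heS => ?_)
      ⟨c⁻¹ * c', fun u hu w hw => ?_⟩
    · have h0 := eq_zero_of_mem_grsCode hα hv (mem_symplecticCode.mp heS) (by rw [hxw]; omega)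
      rw [h0, hammingNorm_zero] at hxw
      omega
    · rw [mul_assoc, ← hc' u hu w hw, hc, LinearMap.smul_apply, inner_smul_right,
        inv_mul_cancel_left₀ hc0]
  · intro l a b hpos hwt u hu
    obtain ⟨c, -, hc⟩ := exists_quantumError_eq_smul_weyl l a b
    have h0 : (a, b) ≠ 0 := by
      intro h0
      obtain ⟨rfl, rfl⟩ := Prod.mk_eq_zero.mp h0
      simp [quantumWeight, hammingNorm] at hpos
    rw [hc, LinearMap.smul_apply, inner_smul_right, hsmall a b h0 hwt u hu u hu, mul_zero]
  -- For k = 0 a minimum weight word of `D` itself serves: its weight n - r + 1 equals r + 1, and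
  -- its Weyl operator fixes the code.
  · have hn : n - 2 * r = 0 := by
      by_contra hne
      rw [hdim] at heq
      exact (Nat.one_lt_pow hne hq).ne' heq
    obtain ⟨x, hx, hxw⟩ := exists_mem_grsCode_hammingNorm_eq hα hv hr (by omega)
    obtain ⟨e, rfl⟩ := hbij.2 x
    obtain ⟨c, hc0, hc⟩ := exists_quantumError_eq_smul_weyl 0 e.1 e.2
    refine ⟨0, e.1, e.2, by rw [← hammingNorm_pairToExt hω, hxw]; omega, ?_⟩
    have : Nontrivial (stabilizerCode S) :=
      Module.nontrivial_of_finrank_pos (R := ℂ) (by rw [heq]; exact one_pos)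
    obtain ⟨⟨u, hu⟩, hu0⟩ := exists_ne (0 : stabilizerCode S)
    refine ⟨u, hu, ?_⟩
    rw [hc, LinearMap.smul_apply, inner_smul_right, hu e hx]
    exact mul_ne_zero hc0 (inner_self_ne_zero.mpr fun h => hu0 (Subtype.ext h))

end Bridge

/-! ### Divisibility of the exponents -/

section Exponents

/-- Reducing modulo q - 1 gives s + t + 3 - m = (q-1)L, whence t = mk - L - 1 and s = mk' - L - 2
with k + k' = 2aL + 1. The ranges of `s` and `t` exclude every L. For L = 1 they give k, k' ≤ a,
against k + k' = 2a + 1. -/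
theorem not_dvd_exponent {a m q s t : ℤ} (ha : 1 ≤ a) (hm : 2 ≤ m) (hq : q = 2 * a * m - 1)
    (hs : 0 ≤ s) (ht : 0 ≤ t) (hs' : s ≤ (a + 1) * m - 4) (ht' : t ≤ (a + 1) * m - 4) :
    ¬ m * (q - 1) ∣ s + q * t + (q + 2 - m) := by
  rintro ⟨k, hk⟩
  have hq2 : q - 1 ≠ 0 := by nlinarith
  obtain ⟨L, hL⟩ : q - 1 ∣ s + t + 3 - m := ⟨m * k - t - 1, by linear_combination hk⟩
  have hk' : L + t + 1 = m * k := by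
    apply mul_left_cancel₀ hq2
    linear_combination hk - hL
  have hsL : s = m * (2 * a * L + 1 - k) - L - 2 := by
    subst hq
    linear_combination hL - hk'
  obtain ⟨k', hk2⟩ : ∃ k', k' = 2 * a * L + 1 - k := ⟨_, rfl⟩
  rw [← hk2] at hsL
  have htL : t = m * k - L - 1 := by linear_combination hk'
  subst hsL htL
  rcases lt_trichotomy L 0 with h | h | h
  · have h1 : m * (2 * a * L + 1) ≥ 2 * L + 3 := by
      have : 2 * a * L + 1 = k + k' := by linear_combination -hk2
      rw [this]
      linarith
    have h2 : a * L ≤ L := by nlinarith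
    nlinarith
  · subst h
    have h1 : 1 ≤ k := by
      by_contra! hlt
      nlinarith
    have h2 : 1 ≤ k' := by
      by_contra! hlt
      nlinarith
    linarith
  · rcases (show 1 ≤ L from h).eq_or_lt with h | h
    · subst h
      have h1 : k ≤ a := by
        by_contra! hlt
        nlinarith
      have h2 : k' ≤ a := by
        by_contra! hlt
        nlinarith
      linarith
    · have h1 : m * (2 * a * L + 1) ≤ 2 * ((a + 1) * m) - 8 + 2 * L + 3 := by
        have : 2 * a * L + 1 = k + k' := by linear_combination -hk2
        rw [this]
        linarith
      have h2 : L - 1 ≤ a * (L - 1) := by nlinarith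
      nlinarith

theorem card_filter_not_dvd_range {m : ℕ} (hm : 0 < m) (N : ℕ) :
    ((Finset.range (m * N)).filter fun j => ¬ m ∣ j).card = (m - 1) * N := by
  have h1 : (Finset.range (m * N)).filter (fun j => m ∣ j) = (Finset.range N).image (m * ·) := by
    ext j
    simp only [Finset.mem_filter, Finset.mem_range, Finset.mem_image]
    constructor
    · rintro ⟨h, k, rfl⟩
      exact ⟨k, Nat.lt_of_mul_lt_mul_left h, rfl⟩
    · rintro ⟨k, hk, rfl⟩
      exact ⟨Nat.mul_lt_mul_of_pos_left hk hm, dvd_mul_right _ _⟩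
  have h2 := Finset.card_filter_add_card_filter_not (s := Finset.range (m * N)) (fun j => m ∣ j)
  rw [h1, Finset.card_image_of_injective _ (fun x y h => Nat.eq_of_mul_eq_mul_left hm h), Finset.card_range,
    Finset.card_range] at h2
  rw [Nat.sub_mul, one_mul]
  omega

end Exponents

/-! ### Evaluation points and column multipliers -/

section Points

/-- The right side is a trace, hence lies in `F`, and the norm to `F` is surjective. -/
theorem exists_pow_card_add_one_eq {F K : Type*} [Field F] [Fintype F] [Field K] [Fintype K]
    [Algebra F K] (hfr : finrank F K = 2) (y : K) :
    ∃ v : K, v ^ (Fintype.card F + 1) = y + y ^ Fintype.card F := by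
  obtain ⟨v, hv⟩ := FiniteField.norm_surjective F K (Algebra.trace F K y)
  refine ⟨v, ?_⟩
  have h1 := FiniteField.algebraMap_norm_eq_pow_sum F K v
  rw [hv, FiniteField.algebraMap_trace_eq_sum_pow, hfr] at h1
  simpa [Finset.sum_range_succ, add_comm, Nat.card_eq_fintype_card] using h1.symm

theorem IsPrimitiveRoot.sum_range_pow_mul_eq_zero {K : Type*} [Field K] {θ : K} {N e : ℕ}
    (hθ : IsPrimitiveRoot θ N) (he : ¬ N ∣ e) : ∑ j ∈ Finset.range N, θ ^ (j * e) = 0 := by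
  have h1 : θ ^ e - 1 ≠ 0 := sub_ne_zero.mpr fun h => he ((hθ.pow_eq_one_iff_dvd e).mp h)
  have h2 : (∑ j ∈ Finset.range N, (θ ^ e) ^ j) * (θ ^ e - 1) = 0 := by
    rw [geom_sum_mul, ← pow_mul, mul_comm, pow_mul, hθ.pow_eq_one, one_pow, sub_self]
  rw [← (mul_eq_zero.mp h2).resolve_right h1]
  exact Finset.sum_congr rfl fun j _ => by rw [mul_comm, pow_mul]

theorem exists_isPrimitiveRoot_card_sub_one (K : Type*) [Field K] [Fintype K] :
    ∃ g : K, IsPrimitiveRoot g (Fintype.card K - 1) := by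
  classical
  obtain ⟨g, hg⟩ := IsCyclic.exists_ofOrder_eq_natCard (α := Kˣ)
  refine ⟨g, ?_⟩
  rw [← Fintype.card_units, ← Nat.card_eq_fintype_card, ← hg, ← orderOf_units]
  exact IsPrimitiveRoot.orderOf _

theorem exists_points_multipliers {F K : Type*} [Field F] [Fintype F] [Field K] [Fintype K]
    [Algebra F K] (hfr : finrank F K = 2) {a m r N : ℕ} (hN : Fintype.card F = N + 1)
    (hq : N + 2 = 2 * a * m) (hm : 2 ≤ m)
    (hr : r + 3 ≤ (a + 1) * m) :
    ∃ α v : Fin ((m - 1) * N) → K, Function.Injective α ∧ (∀ i, v i ≠ 0) ∧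
      ∀ s < r, ∀ t < r, ∑ i, v i ^ (Fintype.card F + 1) * α i ^ (s + Fintype.card F * t) = 0 := by
  have hNpos : 0 < N := by
    have := Fintype.one_lt_card (α := F)
    omega
  have ha : 1 ≤ a := by
    rcases Nat.eq_zero_or_pos a with rfl | h
    · omega
    · exact h
  have hK : Fintype.card K = Fintype.card F ^ 2 := by
    rw [Module.card_eq_pow_finrank (K := F), hfr]
  have hKN : Fintype.card K - 1 = 2 * a * (m * N) := by
    rw [hK, hN, ← mul_assoc, ← hq]
    exact Nat.sub_eq_of_eq_add (by ring)
  have hpos : 0 < 2 * a * (m * N) := by positivity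
  obtain ⟨g, hg⟩ := exists_isPrimitiveRoot_card_sub_one K
  rw [hKN] at hg
  have hθ : IsPrimitiveRoot (g ^ (2 * a)) (m * N) := hg.pow hpos rfl
  have hg0 : g ≠ 0 := hg.ne_zero hpos.ne'
  obtain ⟨θ, hθdef⟩ : ∃ θ, θ = g ^ (2 * a) := ⟨_, rfl⟩
  rw [← hθdef] at hθ
  have hneg : (g ^ (a * m)) ^ N = -1 := by
    rw [← pow_mul]
    exact (hg.pow hpos (by ring : 2 * a * (m * N) = a * m * N * 2)).eq_neg_one_of_two_right
  -- Here N = q - 1, so c = q + 2 - m. As c + m = 2am + 1, `c` is coprime to `m`.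
  obtain ⟨c, hc⟩ : ∃ c, c + m = N + 3 := ⟨N + 3 - m, by
    have : m ≤ N + 3 := by nlinarith
    omega⟩
  have hcop : Nat.Coprime m c := by
    have h1 : Nat.gcd m c ∣ 2 * a * m + 1 := by
      rw [show 2 * a * m + 1 = c + m by omega]
      exact dvd_add (Nat.gcd_dvd_right m c) (Nat.gcd_dvd_left m c)
    exact Nat.dvd_one.mp ((Nat.dvd_add_right ((Nat.gcd_dvd_left m c).mul_left (2 * a))).mp h1)
  have hndvd : ∀ s < r, ∀ t < r, ¬ m * N ∣ s + (N + 1) * t + c := by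
    intro s hs t ht hdvd
    have hq' : ((N + 1 : ℕ) : ℤ) = 2 * a * m - 1 := by
      have : ((N + 2 : ℕ) : ℤ) = (2 * a * m : ℕ) := by rw [hq]
      push_cast at this ⊢
      linarith
    have hr' : (r : ℤ) + 3 ≤ (a + 1) * m := by exact_mod_cast hr
    refine not_dvd_exponent (a := a) (m := m) (s := s) (t := t) (by exact_mod_cast ha)
      (by exact_mod_cast hm) hq' (by positivity) (by positivity) (by omega) (by omega) ?_
    have hc' : (c : ℤ) = ((N + 1 : ℕ) : ℤ) + 2 - m := by
      push_cast
      omega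
    rw [← hc', show ((N + 1 : ℕ) : ℤ) - 1 = N by push_cast; ring]
    exact_mod_cast hdvd
  have hndvd' : ∀ s < r, ∀ t < r, ¬ m * N ∣ s + (N + 1) * t + (N + 1) * c := by
    intro s hs t ht hdvd
    refine hndvd t ht s hs ?_
    -- Since q² ≡ 1 modulo m(q-1), multiplying by q swaps `s` and `t` and reduces to the previous
    -- exponent.
    have h1 : (N + 1) * (s + (N + 1) * t + (N + 1) * c) =
        (t + (N + 1) * s + c) + m * N * (2 * a * (t + c)) := by
      have h2 : (N + 1) * (N + 1) = 1 + m * N * (2 * a) := by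
        linear_combination N * hq
      linear_combination (t + c) * h2
    exact (Nat.dvd_add_left (dvd_mul_right _ _)).mp (h1 ▸ hdvd.mul_left (N + 1))
  choose w hw using exists_pow_card_add_one_eq (F := F) (K := K) hfr
  obtain ⟨y, hy⟩ : ∃ y : ℕ → K, ∀ j, y j = g ^ (a * m) * θ ^ (j * c) := ⟨_, fun _ => rfl⟩
  have hsum : ∀ j, y j + y j ^ Fintype.card F = y j * (1 - θ ^ (j * c * N)) := by
    intro j
    have h1 : y j ^ N = -θ ^ (j * c * N) := by
      rw [hy, mul_pow, hneg, ← pow_mul, neg_one_mul]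
    rw [hN, pow_succ, h1]
    ring
  have hzero : ∀ j, y j + y j ^ Fintype.card F = 0 ↔ m ∣ j := by
    intro j
    have hy0 : y j ≠ 0 := by
      rw [hy, hθdef]
      exact mul_ne_zero (pow_ne_zero _ hg0) (pow_ne_zero _ (pow_ne_zero _ hg0))
    rw [hsum, mul_eq_zero, or_iff_right hy0, sub_eq_zero, eq_comm, hθ.pow_eq_one_iff_dvd,
      Nat.mul_dvd_mul_iff_right hNpos]
    exact ⟨hcop.dvd_of_dvd_mul_right, fun h => h.mul_right c⟩
  set S := (Finset.range (m * N)).filter fun j => ¬ m ∣ j with hS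
  let e : Fin ((m - 1) * N) ≃ S :=
    (Finset.equivFinOfCardEq (card_filter_not_dvd_range (by omega) N)).symm
  have hmem : ∀ j : S, (j : ℕ) < m * N ∧ ¬ m ∣ (j : ℕ) := fun j => by
    obtain ⟨j, hj⟩ := j
    rwa [hS, Finset.mem_filter, Finset.mem_range] at hj
  refine ⟨fun i => θ ^ (e i : ℕ), fun i => w (y (e i)), ?_, ?_, ?_⟩
  · intro i i' hi
    exact e.injective (Subtype.ext (hθ.pow_inj (hmem _).1 (hmem _).1 hi))
  · intro i h0
    have h1 := hw (y (e i))
    rw [show w (y (e i)) = 0 from h0, zero_pow (Nat.succ_ne_zero _)] at h1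
    exact (hmem (e i)).2 ((hzero _).mp h1.symm)
  · intro s hs t ht
    simp only [hw]
    -- The indices with m ∣ j can be added back, since their weight y + y^q is zero.
    rw [Equiv.sum_comp e (fun j : S => (y j + y j ^ Fintype.card F) *
        (θ ^ (j : ℕ)) ^ (s + Fintype.card F * t)),
      Finset.sum_coe_sort S (fun j => (y j + y j ^ Fintype.card F) *
        (θ ^ j) ^ (s + Fintype.card F * t)), hS, Finset.sum_filter_of_ne]
    · have h1 : ∀ j, (y j + y j ^ Fintype.card F) * (θ ^ j) ^ (s + Fintype.card F * t) =
          g ^ (a * m) * θ ^ (j * (s + (N + 1) * t + c)) +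
            (g ^ (a * m)) ^ (N + 1) * θ ^ (j * (s + (N + 1) * t + (N + 1) * c)) := by
        intro j
        rw [hy, hN]
        ring
      simp only [h1]
      rw [Finset.sum_add_distrib, ← Finset.mul_sum, ← Finset.mul_sum,
        hθ.sum_range_pow_mul_eq_zero (hndvd s hs t ht),
        hθ.sum_range_pow_mul_eq_zero (hndvd' s hs t ht), mul_zero, mul_zero, add_zero]
    · intro j _ hj hdvd
      exact hj (by rw [(hzero j).mpr hdvd, zero_mul])

end Points

theorem mainTheorem2 {F : Type*} [Field F] [Fintype F] [DecidableEq F]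
    (q a m d : ℕ) (hF : Fintype.card F = q) (hodd : Odd q)
    (hq : (q : ℤ) = 2 * a * m - 1) (hm : 2 ≤ m)
    (hd : 2 ≤ d) (hd' : (d : ℤ) ≤ (a + 1) * m - 2) :
    ∃ n k : ℕ,
      (n : ℚ) = ((q : ℚ) ^ 2 - 1) / (2 * a) - q + 1 ∧
      (k : ℚ) = ((q : ℚ) ^ 2 - 1) / (2 * a) - q - 2 * d + 3 ∧
      ∃ Q : Submodule ℂ (QState F n), IsQuantumMDSCode Q k d := by
  subst hF
  have hcard := Fintype.one_lt_card (α := F)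
  obtain ⟨N, hN⟩ : ∃ N, Fintype.card F = N + 1 := ⟨Fintype.card F - 1, by omega⟩
  have hNm : N + 2 = 2 * a * m := by
    rw [hN] at hq
    push_cast at hq
    have : ((N + 2 : ℕ) : ℤ) = (2 * a * m : ℕ) := by
      push_cast
      linarith
    exact_mod_cast this
  have ha : 1 ≤ a := by
    rcases Nat.eq_zero_or_pos a with rfl | h
    · omega
    · exact h
  obtain ⟨r, rfl⟩ : ∃ r, d = r + 1 := ⟨d - 1, by omega⟩
  have hr : r + 3 ≤ (a + 1) * m := by
    have : ((r : ℤ) + 3) ≤ (a + 1) * m := by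
      push_cast at hd'
      linarith
    exact_mod_cast this
  -- This keeps the natural subtraction in k = n - 2r exact.
  have h2r : 2 * r ≤ (m - 1) * N := by
    obtain ⟨m, rfl⟩ : ∃ m', m = m' + 2 := ⟨m - 2, by omega⟩
    rw [show m + 2 - 1 = m + 1 by omega]
    nlinarith [Nat.zero_le (a * m), Nat.zero_le (a * m * m), mul_le_mul ha le_rfl m.zero_le a.zero_le]
  have h2 : (2 : F) ≠ 0 := by
    refine Ring.two_ne_zero fun h => ?_
    rw [FiniteField.even_card_iff_char_two] at h
    rw [Nat.odd_iff] at hodd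
    omega
  let p := ringChar F
  have : Fact p.Prime := ⟨CharP.char_is_prime F p⟩
  let K := FiniteField.Extension F p 2
  let : Fintype K := Fintype.ofFinite K
  have hfr : finrank F K = 2 := FiniteField.finrank_extension F p 2
  obtain ⟨α, v, hα, hv, h⟩ := exists_points_multipliers (F := F) (K := K) hfr hN hNm hm hr
  have ha' : (a : ℚ) ≠ 0 := by positivity
  have hNq : (N : ℚ) = 2 * a * m - 2 := by
    have : ((N + 2 : ℕ) : ℚ) = (2 * a * m : ℕ) := by rw [hNm]
    push_cast at this
    linarith
  have hlen : (((m - 1) * N : ℕ) : ℚ) =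
      (((Fintype.card F : ℕ) : ℚ) ^ 2 - 1) / (2 * a) - (Fintype.card F : ℕ) + 1 := by
    rw [hN, Nat.cast_mul, Nat.cast_sub (by omega)]
    push_cast
    rw [hNq]
    field_simp
    ring
  refine ⟨(m - 1) * N, (m - 1) * N - 2 * r, hlen, ?_, exists_isQuantumMDSCode_of_grs h2
    (by rw [Module.card_eq_pow_finrank (K := F), hfr]) hα hv (by omega) h2r h⟩
  rw [Nat.cast_sub h2r, hlen]
  push_cast
  ring
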